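/- Let $\Omega\subset\mathbb{R}^d$ be compact and convex, let $\mathcal{P}(\Omega)$ be the set of Borel probability measures on $\Omega$ with the weak topology, $\mathcal{P}_2(\mathbb{R}^d)$ the set of Borel probability measures on $\mathbb{R}^d$ with finite second moment, and $W_2$ the $L^2$-Wasserstein distance. Let $\mathcal{E}:\mathcal{P}(\Omega)\to(-\infty,+\infty]$ be lower semicontinuous, $\rho_0\in\mathcal{P}(\Omega)$ with $\mathcal{E}(\rho_0)<\infty$, and let $0\le\beta<1$ (with $\alpha=1+\beta$), $0\le\theta<\tfrac12$ and $C>0$. Then there is a constant $K$, depending only on $\Omega$, $\mathcal{E}$, $\rho_0$, $\beta$, $\theta$ and $C$, such that the following holds. Let $T>0$ and let $\mathsf{E}_\alpha:\mathcal{P}_2(\mathbb{R}^d)\times\mathcal{P}_2(\mathbb{R}^d)\to\mathcal{P}_2(\mathbb{R}^d)$ be $\theta$-dissipative, i.e. $W_2(\mu_1,\mathsf{E}_\alpha(\mu_0,\mu_1))\le\theta\,W_2(\mu_0,\mu_1)$ for all $\mu_0,\mu_1\in\mathcal{P}_2(\mathbb{R}^d)$. For every $N\ge1$, with $\tau=T/N$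 and $t_n=n\tau$, let $\rho_1=\rho_1^N\in\mathcal{P}(\Omega)$ satisfy $W_2^2(\rho_0,\rho_1)\le C\tau$ and $\mathcal{E}(\rho_1)\le\mathcal{E}(\rho_0)$, and let $\rho_2,\dots,\rho_N\in\mathcal{P}(\Omega)$ (depending on $N$) be given by the EVBDF2 scheme $$\rho_n\in\operatorname*{argmin}_{\rho\in\mathcal{P}(\Omega)}\ \frac{W_2^2\big(\rho,\mathsf{E}_\alpha(\rho_{n-2},\rho_{n-1})\big)}{2(1-\beta)\tau}+\mathcal{E}(\rho),\qquad 2\le n\le N.$$ Let $\rho_\tau:[0,T]\to\mathcal{P}(\Omega)$ be the piecewise constant curve with $\rho_\tau(0)=\rho_0$ and $\rho_\tau(t)=\rho_{n-1}$ for $t\in(t_{n-1},t_n]$, $1\le n\le N$. Then: 1. Every subsequence of $(\rho_{T/N})_{N\ge1}$ has a further subsequence which converges, uniformly on $[0,T]$ in the $W_2$ distance, to a curve $\varrho:[0,T]\to\mathcal{P}(\Omega)$ that is absolutely continuous with respect to $W_2$ (there is $m\in L^1(0,T)$ with $W_2(\varrho(s),\varrho(t))\le\int_s^t m(r)\,\mathrm{d}r$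 for $0\le s\le t\le T$) and $\tfrac12$-Hölder: $W_2(\varrho(s),\varrho(t))\le K|t-s|^{1/2}$ for all $s,t\in[0,T]$. 2. For every $N\ge1$ and every curve $\tilde\rho_\tau:[0,T]\to\mathcal{P}_2(\mathbb{R}^d)$ which on each $[t_{n-1},t_n]$, $1\le n\le N$, is a constant speed $W_2$-geodesic from $\rho_{n-1}$ to $\rho_n$, one has $W_2(\rho_\tau(t),\tilde\rho_\tau(t))\le K\sqrt{\tau}$ for all $t\in[0,T]$. -/

import Mathlib

open MeasureTheory Set Filter Topology
open scoped ENNReal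

noncomputable section

namespace EVBDF2

/-- Euclidean space `ℝ^d`. -/
abbrev Space (d : ℕ) : Type := EuclideanSpace ℝ (Fin d)

/-- `P₂(ℝ^d)`: Borel probability measures on `ℝ^d` with finite second moment. -/
abbrev P2 (d : ℕ) : Type :=
  {μ : ProbabilityMeasure (Space d) // ∫⁻ x, ‖x‖ₑ ^ 2 ∂(μ : Measure (Space d)) < ∞}

/-- `P(Ω)`: Borel probability measures on `ℝ^d` concentrated on `Ω`, with the topology of weak
convergence (inherited from `ProbabilityMeasure`). -/
abbrev POn {d : ℕ} (Ω : Set (Space d)) : Type :=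
  {μ : ProbabilityMeasure (Space d) // (μ : Measure (Space d)) Ωᶜ = 0}

/-- For compact `Ω`, the inclusion `P(Ω) ⊆ P₂(ℝ^d)`. -/
def POn.toP2 {d : ℕ} {Ω : Set (Space d)} (hΩ : IsCompact Ω) (μ : POn Ω) : P2 d :=
  ⟨μ.1, by
    obtain ⟨R, hR⟩ := hΩ.isBounded.exists_norm_le
    have hae : ∀ᵐ x ∂(μ.1 : Measure (Space d)), ‖x‖ₑ ^ 2 ≤ ENNReal.ofReal R ^ 2 := by
      have h : ∀ᵐ x ∂(μ.1 : Measure (Space d)), x ∈ Ω := μ.2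
      filter_upwards [h] with x hx
      gcongr
      rw [← ofReal_norm]
      exact ENNReal.ofReal_le_ofReal (hR x hx)
    refine (lintegral_mono_ae hae).trans_lt ?_
    rw [lintegral_const, measure_univ, mul_one]
    exact ENNReal.pow_lt_top ENNReal.ofReal_lt_top⟩

/-- `Π(μ, ν)`: measures on `ℝ^d × ℝ^d` with marginals `μ` and `ν`. -/
def couplings {d : ℕ} (μ ν : ProbabilityMeasure (Space d)) : Set (Measure (Space d × Space d)) :=
  {γ | γ.map Prod.fst = μ ∧ γ.map Prod.snd = ν}

/-- The squared `L²`-Wasserstein distance, with values in `[0, ∞]`. -/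
def W2sq {d : ℕ} (μ ν : ProbabilityMeasure (Space d)) : ℝ≥0∞ :=
  ⨅ γ ∈ couplings μ ν, ∫⁻ p, ‖p.1 - p.2‖ₑ ^ 2 ∂γ

/-- The `L²`-Wasserstein distance as a real number; it is only used between measures with finite
second moment, for which `W2sq` is finite (see `W2sq_lt_top`). -/
def W2 {d : ℕ} (μ ν : ProbabilityMeasure (Space d)) : ℝ :=
  Real.sqrt (W2sq μ ν).toReal

theorem W2sq_lt_top {d : ℕ} (μ ν : P2 d) : W2sq μ.1 ν.1 < ∞ := by
  have hmem : (μ.1 : Measure (Space d)).prod (ν.1 : Measure (Space d)) ∈ couplings μ.1 ν.1 := by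
    constructor <;> simp
  refine (iInf₂_le _ hmem).trans_lt ?_
  have hle : ∀ p : Space d × Space d,
      ‖p.1 - p.2‖ₑ ^ 2 ≤ 2 * (‖p.1‖ₑ ^ 2) + 2 * (‖p.2‖ₑ ^ 2) := by
    intro p
    have h1 : ‖p.1 - p.2‖₊ ^ 2 ≤ 2 * ‖p.1‖₊ ^ 2 + 2 * ‖p.2‖₊ ^ 2 := by
      rw [← NNReal.coe_le_coe]
      push_cast
      nlinarith [norm_sub_le p.1 p.2, norm_nonneg (p.1 - p.2), norm_nonneg p.1,
        norm_nonneg p.2, sq_nonneg (‖p.1‖ - ‖p.2‖)]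
    simp only [enorm_eq_nnnorm]
    exact_mod_cast h1
  refine (lintegral_mono hle).trans_lt ?_
  rw [lintegral_add_left (by fun_prop), lintegral_const_mul _ (by fun_prop),
    lintegral_const_mul _ (by fun_prop)]
  have e1 : ∫⁻ p : Space d × Space d, ‖p.1‖ₑ ^ 2
      ∂((μ.1 : Measure (Space d)).prod (ν.1 : Measure (Space d))) < ∞ := by
    rw [lintegral_prod _ (by fun_prop)]
    simpa using μ.2
  have e2 : ∫⁻ p : Space d × Space d, ‖p.2‖ₑ ^ 2
      ∂((μ.1 : Measure (Space d)).prod (ν.1 : Measure (Space d))) < ∞ := by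
    rw [lintegral_prod _ (by fun_prop)]
    simpa using ν.2
  exact ENNReal.add_lt_top.2 ⟨ENNReal.mul_lt_top (by simp) e1, ENNReal.mul_lt_top (by simp) e2⟩

/-- A map `P₂(ℝ^d) × P₂(ℝ^d) → P₂(ℝ^d)` is a `θ`-dissipative extrapolation if
`W₂(μ₁, X(μ₀, μ₁)) ≤ θ W₂(μ₀, μ₁)` for all `μ₀, μ₁`. -/
def IsDissipative {d : ℕ} (X : P2 d → P2 d → P2 d) (θ : ℝ) : Prop :=
  0 ≤ θ ∧ ∀ μ₀ μ₁ : P2 d, W2 μ₁.1 (X μ₀ μ₁).1 ≤ θ * W2 μ₀.1 μ₁.1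

/-- `ρ 0, …, ρ N` is a discrete solution of the EVBDF2 scheme with energy `𝓔`, extrapolation
operator `X`, parameter `β = α - 1` and time step `τ`: for `2 ≤ n ≤ N`, the measure `ρ n` minimizes
`σ ↦ W₂²(σ, X(ρ (n-2), ρ (n-1))) / (2 (1 - β) τ) + 𝓔 σ` over `P(Ω)`. -/
def IsSchemeSolution {d : ℕ} {Ω : Set (Space d)} (hΩ : IsCompact Ω) (𝓔 : POn Ω → EReal)
    (X : P2 d → P2 d → P2 d) (β τ : ℝ) (N : ℕ) (ρ : ℕ → POn Ω) : Prop :=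
  ∀ n : ℕ, n + 2 ≤ N → ∀ σ : POn Ω,
    ((W2 (ρ (n + 2)).1 (X ((ρ n).toP2 hΩ) ((ρ (n + 1)).toP2 hΩ)).1 ^ 2
        / (2 * (1 - β) * τ) : ℝ) : EReal) + 𝓔 (ρ (n + 2))
      ≤ ((W2 σ.1 (X ((ρ n).toP2 hΩ) ((ρ (n + 1)).toP2 hΩ)).1 ^ 2
        / (2 * (1 - β) * τ) : ℝ) : EReal) + 𝓔 σ

/-- The piecewise constant curve: `ρ 0` at time `0` and `ρ (n - 1)` on `((n - 1) τ, n τ]`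
for `n ≥ 1` (see `piecewiseConst_zero` and `piecewiseConst_of_mem`). -/
def piecewiseConst {A : Type*} (τ : ℝ) (ρ : ℕ → A) (t : ℝ) : A :=
  ρ (⌈t / τ⌉₊ - 1)

theorem piecewiseConst_zero {A : Type*} (τ : ℝ) (ρ : ℕ → A) : piecewiseConst τ ρ 0 = ρ 0 := by
  simp [piecewiseConst]

theorem piecewiseConst_of_mem {A : Type*} {τ : ℝ} (hτ : 0 < τ) (ρ : ℕ → A) (n : ℕ) {t : ℝ}
    (ht : t ∈ Ioc (n * τ) ((n + 1) * τ)) : piecewiseConst τ ρ t = ρ n := by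
  have h : ⌈t / τ⌉₊ = n + 1 := by
    rw [Nat.ceil_eq_iff (Nat.succ_ne_zero n)]
    refine ⟨?_, ?_⟩
    · rw [lt_div_iff₀ hτ]
      simpa using ht.1
    · rw [div_le_iff₀ hτ]
      simpa using ht.2
  simp [piecewiseConst, h]

/-- `ω` restricted to `[t₀, t₁]` is a (globally length-minimizing, constant speed) geodesic of
the Wasserstein space. -/
def IsGeodesicOn {d : ℕ} (ω : ℝ → P2 d) (t₀ t₁ : ℝ) : Prop :=
  ∀ s₀ ∈ Icc t₀ t₁, ∀ s₁ ∈ Icc t₀ t₁,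
    W2 (ω s₀).1 (ω s₁).1 = |s₁ - s₀| / |t₁ - t₀| * W2 (ω t₀).1 (ω t₁).1

/-- `ω` is a piecewise geodesic interpolation of `ρ 0, …, ρ N`: on each `[n τ, (n + 1) τ]` with
`n < N` it is a geodesic from `ρ n` to `ρ (n + 1)`. -/
def IsGeodesicInterpolation {d : ℕ} (τ : ℝ) (N : ℕ) (ρ : ℕ → P2 d) (ω : ℝ → P2 d) : Prop :=
  ∀ n : ℕ, n < N → ω (n * τ) = ρ n ∧ ω ((n + 1) * τ) = ρ (n + 1) ∧
    IsGeodesicOn ω (n * τ) ((n + 1) * τ)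

/-- Absolute continuity on `[0, T]` with respect to `W₂`: there is `m ∈ L¹(0, T)` with
`W₂(ω(s), ω(t)) ≤ ∫ₛᵗ m` whenever `0 ≤ s ≤ t ≤ T`. -/
def IsAbsolutelyContinuousCurve {d : ℕ} {Ω : Set (Space d)} (T : ℝ) (ω : ℝ → POn Ω) : Prop :=
  ∃ m : ℝ → ℝ, IntervalIntegrable m volume 0 T ∧
    ∀ s t : ℝ, 0 ≤ s → s ≤ t → t ≤ T → W2 (ω s).1 (ω t).1 ≤ ∫ r in s..t, m r

end EVBDF2

end

/-!
Comparing `ρ_n` with the competitor `ρ_{n-1}` in the minimization problem, and using dissipativity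
to control the distance from `ρ_{n-1}` to the extrapolated measure, gives
`W₂²(ρ_{n-1}, ρ_n) ≤ 4θ² W₂²(ρ_{n-2}, ρ_{n-1}) + 4(1 - β)τ (𝓔(ρ_{n-1}) - 𝓔(ρ_n))`.
The energy is bounded below and `4θ² < 1`, so summing over `n` yields `∑ W₂²(ρ_{n-1}, ρ_n) ≤ A τ`
with `A` independent of `τ` and `T`. In particular every jump, hence the distance to a geodesic
interpolation, is at most `√(A τ)`.

Equivalently, the speeds of the discrete solutions are bounded by `√A` in `L²`. By Cauchy–Schwarz
the piecewise constant curves are `½`-Hölder up to an error `O(√τ)`, so the Arzelà–Ascoli argument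
applies to them, provided `P(Ω)` is compact for `W₂`. That follows from weak compactness, because
`W₂` is weakly continuous on `P(Ω)`: a partition of unity moves every measure by at most `ε` to a
combination of finitely many fixed Dirac masses, on which `W₂²` is controlled by the change of the
weights. Finally, a weak `L²` limit of the speeds bounds the speed of the limit curve, which gives
both absolute continuity and the Hölder estimate.
-/

open scoped NNReal

namespace EVBDF2

open ProbabilityTheory in
theorem exists_measure_map_eq_of_map_snd_eq_map_fst {X Y Z : Type*} [MeasurableSpace X]
    [MeasurableSpace Y] [MeasurableSpace Z] [StandardBorelSpace X] [StandardBorelSpace Z]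
    [Nonempty X] [Nonempty Z] (γ₁ : Measure (X × Y)) (γ₂ : Measure (Y × Z))
    [IsFiniteMeasure γ₁] [IsFiniteMeasure γ₂] (h : γ₁.map Prod.snd = γ₂.map Prod.fst) :
    ∃ π : Measure (Y × X × Z), π.map (fun p => (p.2.1, p.1)) = γ₁ ∧
      π.map (fun p => (p.1, p.2.2)) = γ₂ := by
  have hfst : (γ₁.map Prod.swap).fst = γ₂.fst := by rwa [Measure.fst_map_swap]
  have h₁ : γ₂.fst ⊗ₘ (γ₁.map Prod.swap).condKernel = γ₁.map Prod.swap := by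
    rw [← hfst, Measure.disintegrate]
  have h₂ : γ₂.fst ⊗ₘ γ₂.condKernel = γ₂ := Measure.disintegrate _ _
  refine ⟨γ₂.fst ⊗ₘ ((γ₁.map Prod.swap).condKernel ×ₖ γ₂.condKernel), ?_, ?_⟩
  · have factor : (fun p : Y × X × Z => (p.2.1, p.1)) = Prod.swap ∘ Prod.map id Prod.fst := rfl
    rw [factor, ← Measure.map_map measurable_swap (by fun_prop),
      ← Measure.compProd_map measurable_fst, ← Kernel.fst_eq, Kernel.fst_prod, h₁,
      Measure.map_map measurable_swap measurable_swap, Prod.swap_swap_eq, Measure.map_id]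
  · have factor : (fun p : Y × X × Z => (p.1, p.2.2)) = Prod.map id Prod.snd := rfl
    rw [factor, ← Measure.compProd_map measurable_snd, ← Kernel.snd_eq, Kernel.snd_prod, h₂]

section Wasserstein

variable {d : ℕ} {μ ν σ : ProbabilityMeasure (Space d)} {γ : Measure (Space d × Space d)}

theorem isProbabilityMeasure_of_mem_couplings (hγ : γ ∈ couplings μ ν) :
    IsProbabilityMeasure γ := by
  have : IsProbabilityMeasure (γ.map Prod.fst) := hγ.1 ▸ inferInstance
  exact Measure.isProbabilityMeasure_of_map Prod.fst

theorem map_swap_mem_couplings (hγ : γ ∈ couplings μ ν) : γ.map Prod.swap ∈ couplings ν μ := by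
  constructor
  · rw [Measure.map_map measurable_fst measurable_swap]
    exact hγ.2
  · rw [Measure.map_map measurable_snd measurable_swap]
    exact hγ.1

theorem map_diag_mem_couplings (μ : ProbabilityMeasure (Space d)) :
    (μ : Measure (Space d)).map (fun x => (x, x)) ∈ couplings μ μ := by
  constructor
  · rw [Measure.map_map measurable_fst (by fun_prop)]
    exact Measure.map_id
  · rw [Measure.map_map measurable_snd (by fun_prop)]
    exact Measure.map_id

/-- The `L²`-Wasserstein distance with values in `[0, ∞]`, defined between arbitrary probability
measures as the infimum of the `L²`-norms of `x - y` over the couplings. -/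
noncomputable def eW2 (μ ν : ProbabilityMeasure (Space d)) : ℝ≥0∞ :=
  ⨅ γ ∈ couplings μ ν, eLpNorm (fun p => p.1 - p.2) 2 γ

theorem eW2_sq (μ ν : ProbabilityMeasure (Space d)) : eW2 μ ν ^ 2 = W2sq μ ν := by
  have sq_eLpNorm (γ : Measure (Space d × Space d)) :
      eLpNorm (fun p => p.1 - p.2) 2 γ ^ 2 = ∫⁻ p, ‖p.1 - p.2‖ₑ ^ 2 ∂γ := by
    simpa using eLpNorm_nnreal_pow_eq_lintegral (f := fun p : Space d × Space d => p.1 - p.2)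
      (p := 2) (μ := γ) two_ne_zero
  have sq_iInf := (ENNReal.orderIsoRpow 2 two_pos).map_iInf₂
    fun γ (_ : γ ∈ couplings μ ν) => eLpNorm (fun p => p.1 - p.2) 2 γ
  simpa only [eW2, W2sq, ENNReal.orderIsoRpow_apply, ENNReal.rpow_two, sq_eLpNorm] using sq_iInf

theorem eW2_le_of_mem_couplings (hγ : γ ∈ couplings μ ν) :
    eW2 μ ν ≤ eLpNorm (fun p => p.1 - p.2) 2 γ :=
  iInf₂_le γ hγ

theorem eW2_self (μ : ProbabilityMeasure (Space d)) : eW2 μ μ = 0 := by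
  refine le_antisymm ((eW2_le_of_mem_couplings (map_diag_mem_couplings μ)).trans_eq ?_) zero_le
  rw [eLpNorm_map_measure (by fun_prop) (by fun_prop)]
  simp [Function.comp_def]

theorem eW2_comm (μ ν : ProbabilityMeasure (Space d)) : eW2 μ ν = eW2 ν μ := by
  suffices h : ∀ μ ν : ProbabilityMeasure (Space d), eW2 μ ν ≤ eW2 ν μ from
    le_antisymm (h μ ν) (h ν μ)
  refine fun μ ν => le_iInf₂ fun γ hγ =>
    (eW2_le_of_mem_couplings (map_swap_mem_couplings hγ)).trans_eq ?_
  rw [eLpNorm_map_measure (by fun_prop) (by fun_prop), ← eLpNorm_neg]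
  congr 1 with p
  simp

theorem eW2_triangle (μ ν σ : ProbabilityMeasure (Space d)) :
    eW2 μ σ ≤ eW2 μ ν + eW2 ν σ := by
  refine ENNReal.le_iInf₂_add_iInf₂ fun γ₁ h₁ γ₂ h₂ => ?_
  have := isProbabilityMeasure_of_mem_couplings h₁
  have := isProbabilityMeasure_of_mem_couplings h₂
  obtain ⟨π, rfl, rfl⟩ :=
    exists_measure_map_eq_of_map_snd_eq_map_fst γ₁ γ₂ (h₁.2.trans h₂.1.symm)
  have hπ : π.map Prod.snd ∈ couplings μ σ := by
    have hμ := h₁.1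
    have hσ := h₂.2
    rw [Measure.map_map (by fun_prop) (by fun_prop)] at hμ hσ
    constructor <;> rw [Measure.map_map (by fun_prop) (by fun_prop)]
    exacts [hμ, hσ]
  refine (eW2_le_of_mem_couplings hπ).trans ?_
  rw [eLpNorm_map_measure (by fun_prop) (by fun_prop),
    eLpNorm_map_measure (by fun_prop) (by fun_prop),
    eLpNorm_map_measure (by fun_prop) (by fun_prop)]
  calc eLpNorm (fun p => p.2.1 - p.2.2) 2 π
      = eLpNorm ((fun p => p.2.1 - p.1) + fun p => p.1 - p.2.2) 2 π := by congr 1 with p; simp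
    _ ≤ _ := eLpNorm_add_le (by fun_prop) (by fun_prop) one_le_two

theorem W2_eq_toReal_eW2 (μ ν : ProbabilityMeasure (Space d)) : W2 μ ν = (eW2 μ ν).toReal := by
  rw [W2, ← eW2_sq, ENNReal.toReal_pow, Real.sqrt_sq ENNReal.toReal_nonneg]

theorem eW2_ne_top (μ ν : P2 d) : eW2 μ.1 ν.1 ≠ ∞ := by
  have h := W2sq_lt_top μ ν
  rw [← eW2_sq] at h
  exact fun htop => by simp [htop] at h

end Wasserstein

/-- The Wasserstein space: `P₂(ℝ^d)` with the distance `W2`, which gets a type of its own because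
`P2 d` already carries the weak topology. -/
def WassersteinSpace (d : ℕ) : Type := P2 d

noncomputable instance (d : ℕ) : PseudoMetricSpace (WassersteinSpace d) where
  dist μ ν := W2 μ.1 ν.1
  dist_self μ := by simp [W2_eq_toReal_eW2, eW2_self]
  dist_comm μ ν := by rw [W2_eq_toReal_eW2, W2_eq_toReal_eW2, eW2_comm]
  dist_triangle μ ν σ := by
    simp only [W2_eq_toReal_eW2]
    rw [← ENNReal.toReal_add (eW2_ne_top μ ν) (eW2_ne_top ν σ)]
    exact ENNReal.toReal_mono (ENNReal.add_ne_top.2 ⟨eW2_ne_top μ ν, eW2_ne_top ν σ⟩)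
      (eW2_triangle μ.1 ν.1 σ.1)

theorem WassersteinSpace.edist_eq {d : ℕ} (μ ν : WassersteinSpace d) :
    edist μ ν = eW2 μ.1 ν.1 := by
  rw [edist_dist]
  exact (congrArg ENNReal.ofReal (W2_eq_toReal_eW2 _ _)).trans
    (ENNReal.ofReal_toReal (eW2_ne_top μ ν))

/-- The inclusion of `P(Ω)` into the Wasserstein space, for compact `Ω`. -/
def POn.toWassersteinSpace {d : ℕ} {Ω : Set (Space d)} (hΩ : IsCompact Ω) (μ : POn Ω) :
    WassersteinSpace d :=
  μ.toP2 hΩ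

theorem exists_partitionOfUnity_isSubordinate_ball {X : Type*} [MetricSpace X] {K : Set X}
    (hK : IsCompact K) {ε : ℝ} (hε : 0 < ε) :
    ∃ (s : Finset X) (f : PartitionOfUnity s X K),
      (s : Set X) ⊆ K ∧ f.IsSubordinate fun x => Metric.ball (x : X) ε := by
  obtain ⟨s, hsK, hs, hcover⟩ := hK.finite_cover_balls hε
  lift s to Finset X using hs
  obtain ⟨f, hf⟩ := PartitionOfUnity.exists_isSubordinate hK.isClosed
    (fun x : s => Metric.ball (x : X) ε) (fun _ => Metric.isOpen_ball)
    (hcover.trans_eq (by ext; simp))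
  exact ⟨s, f, hsK, hf⟩

section WeakTopology

variable {d : ℕ} {μ ν : ProbabilityMeasure (Space d)} {γ : Measure (Space d × Space d)}
  {ι : Type*} [Fintype ι]

theorem eW2_le_of_ae_edist_le (hγ : γ ∈ couplings μ ν) {r : ℝ≥0∞}
    (h : ∀ᵐ p ∂γ, edist p.1 p.2 ≤ r) : eW2 μ ν ≤ r := by
  have := isProbabilityMeasure_of_mem_couplings hγ
  simp only [edist_eq_enorm_sub] at h
  simpa using (eW2_le_of_mem_couplings hγ).trans (eLpNorm_le_of_ae_enorm_bound h)

-- The mass common to both measures stays in place; the excess is moved by the product coupling.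
theorem map_diag_add_smul_prod_mem_couplings {κ μ' ν' : Measure (Space d)}
    (hμ : (μ : Measure (Space d)) = κ + μ') (hν : (ν : Measure (Space d)) = κ + ν')
    (hmass : μ' univ = ν' univ) [IsFiniteMeasure μ'] [IsFiniteMeasure ν'] :
    κ.map (fun x => (x, x)) + (μ' univ)⁻¹ • μ'.prod ν' ∈ couplings μ ν := by
  have cancel {m : Measure (Space d)} [IsFiniteMeasure m] (h : m univ = μ' univ) :
      (μ' univ)⁻¹ • μ' univ • m = m := by
    rcases eq_or_ne m 0 with rfl | hm
    · simp
    · rw [← h, smul_smul, ENNReal.inv_mul_cancel (by simpa using hm) (measure_ne_top _ _),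
        one_smul]
  constructor
  · rw [Measure.map_add _ _ measurable_fst, Measure.map_map measurable_fst (by fun_prop),
      Measure.map_smul, Measure.map_fst_prod, ← hmass, cancel rfl, hμ]
    simp [Function.comp_def]
  · rw [Measure.map_add _ _ measurable_snd, Measure.map_map measurable_snd (by fun_prop),
      Measure.map_smul, Measure.map_snd_prod, cancel hmass.symm, hν]
    simp [Function.comp_def]

theorem eW2_sq_le_of_eq_add {κ μ' ν' : Measure (Space d)} (hμ : (μ : Measure (Space d)) = κ + μ')
    (hν : (ν : Measure (Space d)) = κ + ν') {r : ℝ≥0∞}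
    (h : ∀ᵐ p ∂μ'.prod ν', edist p.1 p.2 ≤ r) : eW2 μ ν ^ 2 ≤ r ^ 2 * μ' univ := by
  have : IsFiniteMeasure μ' := isFiniteMeasure_of_le μ (hμ ▸ Measure.le_add_left le_rfl)
  have : IsFiniteMeasure ν' := isFiniteMeasure_of_le ν (hν ▸ Measure.le_add_left le_rfl)
  have : IsFiniteMeasure κ := isFiniteMeasure_of_le μ (hμ ▸ Measure.le_add_right le_rfl)
  have hmass : μ' univ = ν' univ := by
    rw [← ENNReal.add_right_inj (measure_ne_top κ univ), ← Measure.add_apply, ← Measure.add_apply,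
      ← hμ, ← hν, measure_univ, measure_univ]
  have cost : ∫⁻ p, ‖p.1 - p.2‖ₑ ^ 2 ∂μ'.prod ν' ≤ r ^ 2 * (μ' univ * ν' univ) := by
    rw [← Measure.prod_prod, univ_prod_univ, ← lintegral_const]
    refine lintegral_mono_ae (h.mono fun p hp => ?_)
    rw [← edist_eq_enorm_sub]
    gcongr
  calc eW2 μ ν ^ 2 = W2sq μ ν := eW2_sq μ ν
    _ ≤ ∫⁻ p, ‖p.1 - p.2‖ₑ ^ 2 ∂(κ.map (fun x => (x, x)) + (μ' univ)⁻¹ • μ'.prod ν') :=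
        iInf₂_le _ (map_diag_add_smul_prod_mem_couplings hμ hν hmass)
    _ = (μ' univ)⁻¹ * ∫⁻ p, ‖p.1 - p.2‖ₑ ^ 2 ∂μ'.prod ν' := by
        rw [lintegral_add_measure, lintegral_map (by fun_prop) (by fun_prop),
          lintegral_smul_measure]
        simp
    _ ≤ (μ' univ)⁻¹ * (r ^ 2 * (μ' univ * μ' univ)) := by rw [hmass] at cost ⊢; gcongr
    _ = r ^ 2 * ((μ' univ)⁻¹ * μ' univ * μ' univ) := by ring
    _ ≤ r ^ 2 * μ' univ := by
        gcongr
        exact mul_le_of_le_one_left' (ENNReal.inv_mul_le_one _)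

theorem eW2_sq_le_of_eq_sum_smul_dirac {p : ι → Space d} {a b : ι → ℝ≥0∞}
    (hμ : (μ : Measure (Space d)) = ∑ i, a i • Measure.dirac (p i))
    (hν : (ν : Measure (Space d)) = ∑ i, b i • Measure.dirac (p i)) {r : ℝ≥0∞}
    (hr : ∀ i j, edist (p i) (p j) ≤ r) : eW2 μ ν ^ 2 ≤ r ^ 2 * ∑ i, (a i - b i) := by
  have split (a b : ι → ℝ≥0∞) : ∑ i, a i • Measure.dirac (p i) =
      ∑ i, min (a i) (b i) • Measure.dirac (p i) + ∑ i, (a i - b i) • Measure.dirac (p i) := by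
    simp only [← Finset.sum_add_distrib, ← add_smul, add_comm (min _ _), tsub_add_min]
  have hν' := hν.trans (split b a)
  simp only [min_comm (b _)] at hν'
  have ae_mem_range (c : ι → ℝ≥0∞) : ∀ᵐ x ∂∑ i, c i • Measure.dirac (p i), x ∈ range p :=
    ae_finsetSum_measure_iff.2 fun i _ => Measure.ae_smul_measure (by simp [ae_dirac_eq]) _
  refine (eW2_sq_le_of_eq_add (r := r) (hμ.trans (split a b)) hν' ?_).trans_eq (by simp)
  filter_upwards [Measure.quasiMeasurePreserving_fst.ae (ae_mem_range _),
    Measure.quasiMeasurePreserving_snd.ae (ae_mem_range _)]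
  rintro ⟨_, _⟩ ⟨i, rfl⟩ ⟨j, rfl⟩
  exact hr i j

theorem exists_eq_sum_smul_dirac_eW2_le {f : ι → Space d → ℝ≥0∞} (hf : ∀ i, Measurable (f i))
    (hsum : ∀ᵐ x ∂(μ : Measure (Space d)), ∑ i, f i x = 1) {p : ι → Space d} {r : ℝ≥0∞}
    (hr : ∀ i x, f i x ≠ 0 → edist x (p i) ≤ r) :
    ∃ ν : ProbabilityMeasure (Space d),
      (ν : Measure (Space d)) = ∑ i, (∫⁻ x, f i x ∂(μ : Measure (Space d))) • Measure.dirac (p i) ∧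
        eW2 μ ν ≤ r := by
  let γ : Measure (Space d × Space d) :=
    ∑ i, ((μ : Measure (Space d)).withDensity (f i)).map fun x => (x, p i)
  have hfst : γ.map Prod.fst = μ := by
    simp only [γ, Measure.map_finset_sum measurable_fst.aemeasurable,
      Measure.map_map measurable_fst (measurable_prodMk_right (y := p _)), Function.comp_def,
      Measure.map_id']
    rw [← Measure.sum_fintype, ← withDensity_tsum hf, tsum_fintype]
    refine (withDensity_congr_ae ?_).trans withDensity_one
    filter_upwards [hsum] with x hx
    simpa using hx
  have hsnd : γ.map Prod.snd =
      ∑ i, (∫⁻ x, f i x ∂(μ : Measure (Space d))) • Measure.dirac (p i) := by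
    simp only [γ, Measure.map_finset_sum measurable_snd.aemeasurable,
      Measure.map_map measurable_snd (measurable_prodMk_right (y := p _)), Function.comp_def,
      Measure.map_const, withDensity_apply _ MeasurableSet.univ, Measure.restrict_univ]
  have : IsProbabilityMeasure (γ.map Prod.fst) := hfst ▸ inferInstance
  have : IsProbabilityMeasure γ := Measure.isProbabilityMeasure_of_map Prod.fst
  have : IsProbabilityMeasure (γ.map Prod.snd) :=
    Measure.isProbabilityMeasure_map measurable_snd.aemeasurable
  refine ⟨⟨γ.map Prod.snd, this⟩, hsnd, eW2_le_of_ae_edist_le ⟨hfst, rfl⟩ ?_⟩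
  refine ae_finsetSum_measure_iff.2 fun i _ => ?_
  rw [ae_map_iff (by fun_prop) (measurableSet_le (by fun_prop) measurable_const),
    ae_withDensity_iff (hf i)]
  exact ae_of_all _ (hr i)

theorem continuous_lintegral_ofReal_of_le_one {X : Type*} [TopologicalSpace X] [MeasurableSpace X]
    [OpensMeasurableSpace X] (f : C(X, ℝ)) (hf : ∀ x, f x ≤ 1) :
    Continuous fun μ : ProbabilityMeasure X => ∫⁻ x, ENNReal.ofReal (f x) ∂(μ : Measure X) := by
  let g : BoundedContinuousFunction X ℝ≥0 :=
    BoundedContinuousFunction.mkOfBound (ContinuousMap.realToNNReal.comp f) 1 fun x y => by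
      have hx : (f x).toNNReal ∈ Icc 0 1 := ⟨zero_le, Real.toNNReal_le_one.2 (hf x)⟩
      have hy : (f y).toNNReal ∈ Icc 0 1 := ⟨zero_le, Real.toNNReal_le_one.2 (hf y)⟩
      exact abs_sub_le_of_nonneg_of_le hx.1 hx.2 hy.1 hy.2
  exact continuous_iff_continuousAt.2 fun μ =>
    ProbabilityMeasure.tendsto_iff_forall_lintegral_tendsto.1 tendsto_id g

theorem continuous_toWassersteinSpace_of_eq_sum_smul_dirac {Ω : Set (Space d)} (hΩ : IsCompact Ω)
    {X : Type*} [TopologicalSpace X] {q : X → POn Ω} {w : ι → X → ℝ≥0∞} {p : ι → Space d}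
    (hp : ∀ i, p i ∈ Ω) (hw : ∀ i, Continuous (w i))
    (hq : ∀ x, ((q x).1 : Measure (Space d)) = ∑ i, w i x • Measure.dirac (p i)) :
    Continuous fun x => (q x).toWassersteinSpace hΩ := by
  have weight_ne_top (i : ι) (x : X) : w i x ≠ ∞ := by
    have mass : ∑ i, w i x = 1 := by
      simpa using (congrArg (fun m : Measure (Space d) => m univ) (hq x)).symm
    exact fun h => by simpa [mass] using (Finset.single_le_sum (f := (w · x)) (fun _ _ => zero_le)
      (Finset.mem_univ i)).trans' h.ge
  refine continuous_iff_continuousAt.2 fun x => tendsto_iff_edist_tendsto_0.2 ?_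
  have sq_le (y : X) :
      edist ((q y).toWassersteinSpace hΩ) ((q x).toWassersteinSpace hΩ) ^ 2 ≤
        Metric.ediam Ω ^ 2 * ∑ i, (w i y - w i x) := by
    rw [WassersteinSpace.edist_eq]
    exact eW2_sq_le_of_eq_sum_smul_dirac (hq y) (hq x) fun i j =>
      Metric.edist_le_ediam_of_mem (hp i) (hp j)
  have bound_tendsto :
      Tendsto (fun y => Metric.ediam Ω ^ 2 * ∑ i, (w i y - w i x)) (𝓝 x) (𝓝 0) := by
    have sum_tendsto := tendsto_finsetSum Finset.univ fun i _ =>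
      ENNReal.Tendsto.sub ((hw i).tendsto x) (tendsto_const_nhds (x := w i x))
        (.inl (weight_ne_top i x))
    simpa using ENNReal.Tendsto.const_mul sum_tendsto
      (.inr (ENNReal.pow_ne_top hΩ.isBounded.ediam_ne_top))
  have sq_tendsto := tendsto_of_tendsto_of_tendsto_of_le_of_le tendsto_const_nhds bound_tendsto
    (fun _ => zero_le) sq_le
  have sqrt_tendsto :=
    ((ENNReal.continuous_rpow_const (y := ((2 : ℕ) : ℝ)⁻¹)).tendsto 0).comp sq_tendsto
  simpa only [Function.comp_def, ENNReal.pow_rpow_inv_natCast two_ne_zero,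
    ENNReal.zero_rpow_of_pos (show 0 < ((2 : ℕ) : ℝ)⁻¹ by norm_num)] using sqrt_tendsto

theorem exists_continuous_toWassersteinSpace_edist_le {Ω : Set (Space d)} (hΩ : IsCompact Ω)
    {ε : ℝ} (hε : 0 < ε) :
    ∃ q : POn Ω → POn Ω, Continuous (fun μ => (q μ).toWassersteinSpace hΩ) ∧
      ∀ μ, edist (μ.toWassersteinSpace hΩ) ((q μ).toWassersteinSpace hΩ) ≤ ENNReal.ofReal ε := by
  obtain ⟨s, f, hsΩ, hf⟩ := exists_partitionOfUnity_isSubordinate_ball hΩ hε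
  have sum_eq_one (μ : POn Ω) :
      ∀ᵐ x ∂(μ.1 : Measure (Space d)), ∑ i, ENNReal.ofReal (f i x) = 1 := by
    filter_upwards [show ∀ᵐ x ∂(μ.1 : Measure (Space d)), x ∈ Ω from μ.2] with x hx
    rw [← ENNReal.ofReal_sum_of_nonneg fun i _ => f.nonneg i x, ← finsum_eq_sum_of_fintype,
      f.sum_eq_one hx, ENNReal.ofReal_one]
  have edist_le (i : s) (x : Space d) (h : ENNReal.ofReal (f i x) ≠ 0) :
      edist x i ≤ ENNReal.ofReal ε := by
    have hx : x ∈ tsupport (f i) := subset_tsupport _ fun h0 => h (by simp [h0])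
    rw [edist_dist]
    exact ENNReal.ofReal_le_ofReal (Metric.mem_ball.1 (hf i hx)).le
  choose q hq hqε using fun μ : POn Ω => exists_eq_sum_smul_dirac_eW2_le
    (fun i => (f i).continuous.measurable.ennreal_ofReal) (sum_eq_one μ) edist_le
  have q_compl (μ : POn Ω) : (q μ : Measure (Space d)) Ωᶜ = 0 := by
    simp [hq, hΩ.measurableSet.compl, hsΩ (Finset.mem_coe.2 (Subtype.prop _))]
  refine ⟨fun μ => ⟨q μ, q_compl μ⟩, ?_, fun μ => ?_⟩
  · exact continuous_toWassersteinSpace_of_eq_sum_smul_dirac hΩ (fun i : s => hsΩ i.2)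
      (fun i => (continuous_lintegral_ofReal_of_le_one (f i) (f.le_one i)).comp
        continuous_subtype_val) hq
  · rw [WassersteinSpace.edist_eq]
    exact hqε μ

theorem continuous_toWassersteinSpace {Ω : Set (Space d)} (hΩ : IsCompact Ω) :
    Continuous (POn.toWassersteinSpace hΩ) := by
  refine continuous_of_uniform_approx_of_continuous fun u hu => ?_
  obtain ⟨ε, hε, hu⟩ := Metric.mem_uniformity_dist.1 hu
  obtain ⟨q, hq, hqε⟩ := exists_continuous_toWassersteinSpace_edist_le hΩ (half_pos hε)
  refine ⟨_, hq, fun μ => hu ?_⟩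
  have := (edist_le_ofReal (half_pos hε).le).1 (hqε μ)
  linarith

theorem compactSpace_POn {Ω : Set (Space d)} (hΩ : IsCompact Ω) : CompactSpace (POn Ω) := by
  have h := isCompact_setOfPred_probabilityMeasure_mass_eq_compl_isCompact_le
    (E := Space d) (u := fun _ => 0) (K := fun _ => Ω) tendsto_const_nhds (fun _ => hΩ)
    (.inl inferInstance)
  have hcompact :
      IsCompact {μ : ProbabilityMeasure (Space d) | (μ : Measure (Space d)) Ωᶜ = 0} := by
    convert h using 1
    ext μ
    simp [ProbabilityMeasure.null_iff_toMeasure_null]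
  exact isCompact_iff_compactSpace.1 hcompact

theorem isCompact_range_toWassersteinSpace {Ω : Set (Space d)} (hΩ : IsCompact Ω) :
    IsCompact (range (POn.toWassersteinSpace hΩ)) := by
  have := compactSpace_POn hΩ
  exact isCompact_range (continuous_toWassersteinSpace hΩ)

end WeakTopology

section ArzelaAscoli

theorem exists_subseq_forall_mem_cauchySeq {X Y : Type*} [PseudoMetricSpace Y] [CompactSpace Y]
    {D : Set X} (hD : D.Countable) (u : ℕ → X → Y) :
    ∃ ψ : ℕ → ℕ, StrictMono ψ ∧ ∀ x ∈ D, CauchySeq fun k => u (ψ k) x := by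
  have := hD.to_subtype
  obtain ⟨a, ψ, hψ, ha⟩ := CompactSpace.tendsto_subseq fun k (x : D) => u k x
  exact ⟨ψ, hψ, fun x hx => (tendsto_pi_nhds.1 ha ⟨x, hx⟩).cauchySeq⟩

variable {X Y : Type*} [PseudoMetricSpace X] [PseudoMetricSpace Y] {K D : Set X} {u : ℕ → X → Y}

/-- Uniform equicontinuity on `K` of the tail of a sequence of functions, where the tail may depend
on the required precision: the functions themselves may have jumps, as long as the jumps become
small along the sequence. -/
def AsymptoticallyEquicontinuousOn (u : ℕ → X → Y) (K : Set X) : Prop :=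
  ∀ ε > 0, ∃ δ > 0, ∀ᶠ k in atTop, ∀ s ∈ K, ∀ t ∈ K, dist s t < δ → dist (u k s) (u k t) < ε

theorem AsymptoticallyEquicontinuousOn.comp_tendsto (hu : AsymptoticallyEquicontinuousOn u K)
    {ψ : ℕ → ℕ} (hψ : Tendsto ψ atTop atTop) :
    AsymptoticallyEquicontinuousOn (fun k => u (ψ k)) K := fun ε hε =>
  let ⟨δ, hδ, h⟩ := hu ε hε
  ⟨δ, hδ, hψ.eventually h⟩

theorem AsymptoticallyEquicontinuousOn.uniformCauchySeqOn
    (hu : AsymptoticallyEquicontinuousOn u K) (hK : IsCompact K) (hDK : D ⊆ K) (hKD : K ⊆ closure D)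
    (hD : ∀ x ∈ D, CauchySeq fun k => u k x) : UniformCauchySeqOn u atTop K := by
  intro V hV
  obtain ⟨ε, hε, hV⟩ := Metric.mem_uniformity_dist.1 hV
  obtain ⟨δ, hδ, hclose⟩ := hu (ε / 3) (by positivity)
  obtain ⟨F, hFD, hF, hcover⟩ := hK.elim_finite_subcover_image (b := D)
    (c := fun x => Metric.ball x δ) (fun _ _ => Metric.isOpen_ball)
    fun t ht => by simpa [dist_comm] using Metric.mem_closure_iff.1 (hKD ht) δ hδ
  have hcauchy : ∀ᶠ p : ℕ × ℕ in atTop ×ˢ atTop, ∀ x ∈ F, dist (u p.1 x) (u p.2 x) < ε / 3 := by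
    rw [prod_atTop_atTop_eq]
    exact hF.eventually_all.2 fun x hx => (cauchySeq_iff_tendsto.1 (hD x (hFD hx))).eventually
      (Metric.dist_mem_uniformity (by positivity))
  filter_upwards [hcauchy, tendsto_fst.eventually hclose, tendsto_snd.eventually hclose]
    with p hp h₁ h₂ t ht
  obtain ⟨x, hx, hxt⟩ := mem_iUnion₂.1 (hcover ht)
  refine hV ?_
  calc dist (u p.1 t) (u p.2 t)
      ≤ dist (u p.1 t) (u p.1 x) + dist (u p.1 x) (u p.2 x) + dist (u p.2 x) (u p.2 t) :=
        dist_triangle4 _ _ _ _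
    _ < ε / 3 + ε / 3 + ε / 3 := by
        gcongr
        exacts [h₁ t ht x (hDK (hFD hx)) hxt, hp x hx,
          h₂ x (hDK (hFD hx)) t ht (by rwa [dist_comm])]
    _ = ε := by ring

theorem AsymptoticallyEquicontinuousOn.exists_subseq_tendstoUniformlyOn [CompactSpace Y]
    (hu : AsymptoticallyEquicontinuousOn u K) (hK : IsCompact K) :
    ∃ ψ : ℕ → ℕ, StrictMono ψ ∧
      ∃ g : X → Y, TendstoUniformlyOn (fun k => u (ψ k)) g atTop K := by
  obtain ⟨D, hDK, hD, hKD⟩ := hK.isSeparable.exists_countable_dense_subset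
  obtain ⟨ψ, hψ, hcauchy⟩ := exists_subseq_forall_mem_cauchySeq hD u
  have hunif := (hu.comp_tendsto hψ.tendsto_atTop).uniformCauchySeqOn hK hDK hKD hcauchy
  have hlim (x : X) : ∃ y, x ∈ K → Tendsto (fun k => u (ψ k) x) atTop (𝓝 y) := by
    by_cases hx : x ∈ K
    · exact (CompleteSpace.complete (hunif.cauchy_map hx)).imp fun y hy _ => hy
    · exact ⟨u 0 x, fun h => absurd h hx⟩
  choose g hg using hlim
  exact ⟨ψ, hψ, g, hunif.tendstoUniformlyOn_of_tendsto hg⟩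

end ArzelaAscoli

section SquareIntegrable

theorem exists_subseq_tendsto_inner {H : Type*} [NormedAddCommGroup H] [InnerProductSpace ℝ H]
    [CompleteSpace H] [TopologicalSpace.SeparableSpace H] {x : ℕ → H} {B : ℝ}
    (hx : ∀ k, ‖x k‖ ≤ B) :
    ∃ ψ : ℕ → ℕ, StrictMono ψ ∧ ∃ a : H, ‖a‖ ≤ B ∧
      ∀ y, Tendsto (fun k => inner ℝ y (x (ψ k))) atTop (𝓝 (inner ℝ y a)) := by
  let dual := InnerProductSpace.toDual ℝ H
  obtain ⟨f, hfB, ψ, hψ, hf⟩ := WeakDual.isSeqCompact_closedBall ℝ H 0 B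
    (x := fun k => StrongDual.toWeakDual (dual (x k))) fun k => by simpa [dual] using hx k
  refine ⟨ψ, hψ, dual.symm (WeakDual.toStrongDual f), by simpa using hfB, fun y => ?_⟩
  have hy := ((WeakDual.eval_continuous y).tendsto f).comp hf
  have eval_dual (k : ℕ) : StrongDual.toWeakDual (dual (x k)) y = inner ℝ y (x k) :=
    (InnerProductSpace.toDual_apply_apply ..).trans (real_inner_comm _ _)
  rw [real_inner_comm, InnerProductSpace.toDual_symm_apply]
  exact hy.congr fun k => eval_dual (ψ k)

theorem intervalIntegrable_coeFn (f : Lp ℝ 2 (volume : Measure ℝ)) (s t : ℝ) :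
    IntervalIntegrable f volume s t :=
  intervalIntegrable_iff.2
    (integrableOn_Lp_of_measure_ne_top f one_le_two (by simp [uIoc]))

theorem intervalIntegral_eq_inner_indicatorConstLp (f : Lp ℝ 2 (volume : Measure ℝ)) {s t : ℝ}
    (hst : s ≤ t) :
    ∫ r in s..t, f r =
      inner ℝ (indicatorConstLp 2 (s := Ioc s t) measurableSet_Ioc measure_Ioc_lt_top.ne (1 : ℝ))
        f := by
  rw [intervalIntegral.integral_of_le hst, L2.inner_indicatorConstLp_one]

theorem intervalIntegral_le_norm_mul_sqrt (f : Lp ℝ 2 (volume : Measure ℝ)) {s t : ℝ}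
    (hst : s ≤ t) : ∫ r in s..t, f r ≤ ‖f‖ * √(t - s) := by
  rw [intervalIntegral_eq_inner_indicatorConstLp f hst, mul_comm]
  refine (real_inner_le_norm _ _).trans_eq ?_
  rw [norm_indicatorConstLp two_ne_zero ENNReal.ofNat_ne_top]
  simp [hst, Real.sqrt_eq_rpow]

variable {Y : Type*} [PseudoMetricSpace Y] {u : ℕ → ℝ → Y} {v : ℕ → Lp ℝ 2 (volume : Measure ℝ)}
  {e : ℕ → ℝ} {a b B : ℝ}

theorem asymptoticallyEquicontinuousOn_of_dist_le_integral (hv : ∀ k, ‖v k‖ ≤ B)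
    (he : Tendsto e atTop (𝓝 0))
    (hu : ∀ k s t, a ≤ s → s ≤ t → t ≤ b → dist (u k s) (u k t) ≤ (∫ r in s..t, v k r) + e k) :
    AsymptoticallyEquicontinuousOn u (Icc a b) := by
  have dist_le (k : ℕ) (s t : ℝ) (hs : s ∈ Icc a b) (ht : t ∈ Icc a b) :
      dist (u k s) (u k t) ≤ B * √(dist s t) + e k := by
    wlog hst : s ≤ t generalizing s t
    · rw [dist_comm, dist_comm s]
      exact this t s ht hs (le_of_not_ge hst)
    refine (hu k s t hs.1 hst ht.2).trans ?_
    rw [dist_comm s, Real.dist_eq, abs_of_nonneg (sub_nonneg.2 hst)]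
    gcongr
    exact (intervalIntegral_le_norm_mul_sqrt (v k) hst).trans (by gcongr; exact hv k)
  intro ε hε
  have hmod : Tendsto (fun x => B * √x) (𝓝 0) (𝓝 0) := by
    have : Continuous fun x => B * √x := by fun_prop
    simpa using this.tendsto 0
  obtain ⟨δ, hδ, hsmall⟩ := Metric.eventually_nhds_iff.1 (hmod.eventually_lt_const (half_pos hε))
  refine ⟨δ, hδ, (he.eventually_lt_const (half_pos hε)).mono fun k hk s hs t ht hst => ?_⟩
  have := hsmall (y := dist s t) (by simpa using hst)
  linarith [dist_le k s t hs ht]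

theorem exists_subseq_tendstoUniformlyOn_of_dist_le_integral [CompactSpace Y]
    (hv : ∀ k, ‖v k‖ ≤ B) (he : Tendsto e atTop (𝓝 0))
    (hu : ∀ k s t, a ≤ s → s ≤ t → t ≤ b → dist (u k s) (u k t) ≤ (∫ r in s..t, v k r) + e k) :
    ∃ ψ : ℕ → ℕ, StrictMono ψ ∧ ∃ g : ℝ → Y,
      TendstoUniformlyOn (fun k => u (ψ k)) g atTop (Icc a b) ∧
      ∃ w : Lp ℝ 2 (volume : Measure ℝ), ‖w‖ ≤ B ∧
        ∀ s t, a ≤ s → s ≤ t → t ≤ b → dist (g s) (g t) ≤ ∫ r in s..t, w r := by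
  obtain ⟨ψ₁, hψ₁, g, hg⟩ := (asymptoticallyEquicontinuousOn_of_dist_le_integral hv he
    hu).exists_subseq_tendstoUniformlyOn isCompact_Icc
  have : Fact ((2 : ℝ≥0∞) ≠ ∞) := ⟨ENNReal.ofNat_ne_top⟩
  obtain ⟨ψ₂, hψ₂, w, hw, hweak⟩ := exists_subseq_tendsto_inner fun k => hv (ψ₁ k)
  have hψ : Tendsto (fun k => ψ₁ (ψ₂ k)) atTop atTop := (hψ₁.comp hψ₂).tendsto_atTop
  refine ⟨ψ₁ ∘ ψ₂, hψ₁.comp hψ₂, g, fun V hV => hψ₂.tendsto_atTop.eventually (hg V hV), w, hw,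
    fun s t hs hst ht => ?_⟩
  have tendsto_u {x : ℝ} (hx : x ∈ Icc a b) :
      Tendsto (fun k => u (ψ₁ (ψ₂ k)) x) atTop (𝓝 (g x)) :=
    (hg.tendsto_at hx).comp hψ₂.tendsto_atTop
  have tendsto_bound : Tendsto (fun k => (∫ r in s..t, v (ψ₁ (ψ₂ k)) r) + e (ψ₁ (ψ₂ k))) atTop
      (𝓝 ((∫ r in s..t, w r) + 0)) := by
    simp only [intervalIntegral_eq_inner_indicatorConstLp _ hst]
    exact (hweak _).add (he.comp hψ)
  rw [add_zero] at tendsto_bound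
  exact le_of_tendsto_of_tendsto'
    ((tendsto_u ⟨hs, hst.trans ht⟩).dist (tendsto_u ⟨hs.trans hst, ht⟩)) tendsto_bound
    fun k => hu _ s t hs hst ht

end SquareIntegrable

section PiecewiseConstant

theorem measurable_piecewiseConst {A : Type*} [MeasurableSpace A] (τ : ℝ) (a : ℕ → A) :
    Measurable (piecewiseConst τ a) :=
  (measurable_from_nat (f := fun n => a (n - 1))).comp
    (Nat.measurable_ceil.comp (measurable_id.div_const τ))

variable {τ : ℝ} (hτ : 0 < τ) (a : ℕ → ℝ)

include hτ

theorem natCeil_sub_one_mul_le {t : ℝ} (ht : 0 ≤ t) : ((⌈t / τ⌉₊ - 1 : ℕ) : ℝ) * τ ≤ t := by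
  rw [← le_div_iff₀ hτ]
  rcases Nat.eq_zero_or_pos ⌈t / τ⌉₊ with h | h
  · simpa [h] using div_nonneg ht hτ.le
  · rw [Nat.cast_pred h]
    linarith [Nat.ceil_lt_add_one (div_nonneg ht hτ.le)]

theorem le_natCeil_sub_one_mul_add (t : ℝ) : t ≤ ((⌈t / τ⌉₊ - 1 : ℕ) : ℝ) * τ + τ := by
  rw [← add_one_mul, ← div_le_iff₀ hτ]
  exact (Nat.le_ceil _).trans (by exact_mod_cast Nat.le_add_of_sub_le le_rfl)

theorem piecewiseConst_eqOn_Ioo (n : ℕ) :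
    EqOn (piecewiseConst τ a) (fun _ => a n) (Ioo (n * τ) ((n + 1 : ℕ) * τ)) := fun t ht =>
  piecewiseConst_of_mem hτ a n ⟨ht.1, by exact_mod_cast ht.2.le⟩

theorem intervalIntegrable_piecewiseConst {m n : ℕ} (hmn : m ≤ n) :
    IntervalIntegrable (piecewiseConst τ a) volume (m * τ) (n * τ) := by
  refine IntervalIntegrable.trans_iterate_Ico (a := fun n : ℕ => n * τ) hmn fun k _ => ?_
  refine (intervalIntegrable_const (c := a k)).congr_uIoo ?_
  rw [uIoo_of_le (by gcongr; exact k.le_succ)]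
  exact (piecewiseConst_eqOn_Ioo hτ a k).symm

theorem integral_piecewiseConst {m n : ℕ} (hmn : m ≤ n) :
    ∫ r in (m * τ)..(n * τ), piecewiseConst τ a r = ∑ k ∈ Finset.Ico m n, τ * a k := by
  rw [← intervalIntegral.sum_integral_adjacent_intervals_Ico (a := fun n : ℕ => n * τ) hmn
    fun k _ => intervalIntegrable_piecewiseConst hτ a k.le_succ]
  refine Finset.sum_congr rfl fun k _ => ?_
  rw [intervalIntegral.integral_congr_Ioo_of_le (by gcongr; exact k.le_succ)
    (piecewiseConst_eqOn_Ioo hτ a k), intervalIntegral.integral_const, smul_eq_mul]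
  push_cast
  ring

theorem memLp_indicator_piecewiseConst (N : ℕ) :
    MemLp ((Ioc 0 (N * τ)).indicator (piecewiseConst τ a)) 2 := by
  have hsq : IntegrableOn (piecewiseConst τ fun n => a n ^ 2) (Ioc 0 (N * τ)) := by
    simpa [intervalIntegrable_iff_integrableOn_Ioc_of_le (mul_nonneg N.cast_nonneg hτ.le)] using
      intervalIntegrable_piecewiseConst hτ (fun n => a n ^ 2) N.zero_le
  refine (memLp_indicator_iff_restrict measurableSet_Ioc).2
    ((memLp_two_iff_integrable_sq (measurable_piecewiseConst τ a).aestronglyMeasurable).2 hsq)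

end PiecewiseConstant

section PiecewiseConstantLp

variable {τ : ℝ} (hτ : 0 < τ) (N : ℕ) (a : ℕ → ℝ)

/-- The piecewise constant function with values `a 0, …, a (N - 1)` on `(0, Nτ]`, extended by zero,
as an element of `L²(ℝ)`. -/
noncomputable def piecewiseConstLp : Lp ℝ 2 (volume : Measure ℝ) :=
  (memLp_indicator_piecewiseConst hτ a N).toLp _

theorem integral_piecewiseConstLp {s t : ℝ} (hs : 0 ≤ s) (hst : s ≤ t) (ht : t ≤ N * τ) :
    ∫ r in s..t, piecewiseConstLp hτ N a r = ∫ r in s..t, piecewiseConst τ a r := by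
  refine intervalIntegral.integral_congr_ae ?_
  filter_upwards [(memLp_indicator_piecewiseConst hτ a N).coeFn_toLp] with r hr hmem
  rw [uIoc_of_le hst] at hmem
  exact hr.trans (indicator_of_mem (Ioc_subset_Ioc hs ht hmem) _)

theorem norm_piecewiseConstLp_sq :
    ‖piecewiseConstLp hτ N a‖ ^ 2 = τ * ∑ k ∈ Finset.range N, a k ^ 2 := by
  have hsq : ∀ᵐ r, piecewiseConstLp hτ N a r * piecewiseConstLp hτ N a r =
      (Ioc 0 (N * τ)).indicator (piecewiseConst τ fun n => a n ^ 2) r := by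
    filter_upwards [(memLp_indicator_piecewiseConst hτ a N).coeFn_toLp] with r hr
    by_cases hmem : r ∈ Ioc 0 (N * τ) <;>
      simp [piecewiseConstLp, hr, hmem, piecewiseConst, sq]
  have hint := integral_piecewiseConst hτ (fun n => a n ^ 2) N.zero_le
  rw [Nat.cast_zero, zero_mul, intervalIntegral.integral_of_le (by positivity)] at hint
  rw [← real_inner_self_eq_norm_sq, L2.inner_def]
  simp only [RCLike.inner_apply, conj_trivial]
  rw [integral_congr_ae hsq, integral_indicator measurableSet_Ioc, hint, Finset.range_eq_Ico,
    Finset.mul_sum]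

theorem piecewiseConstLp_nonneg (ha : ∀ n, 0 ≤ a n) : 0 ≤ᵐ[volume] piecewiseConstLp hτ N a := by
  filter_upwards [(memLp_indicator_piecewiseConst hτ a N).coeFn_toLp] with r hr
  exact (indicator_nonneg (fun _ _ => ha _) r).trans_eq hr.symm

end PiecewiseConstantLp

section StepSpeed

variable {Y : Type*} [PseudoMetricSpace Y] {τ : ℝ} (hτ : 0 < τ) (N : ℕ) (y : ℕ → Y)

/-- The speed, as an element of `L²(ℝ)`, of a motion which visits `y 0, …, y N` at the times
`0, τ, …, Nτ` and travels at constant speed in between. -/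
noncomputable def stepSpeed : Lp ℝ 2 (volume : Measure ℝ) :=
  piecewiseConstLp hτ N fun n => dist (y n) (y (n + 1)) / τ

theorem norm_stepSpeed_le {A : ℝ}
    (hA : ∑ n ∈ Finset.range N, dist (y n) (y (n + 1)) ^ 2 ≤ A * τ) : ‖stepSpeed hτ N y‖ ≤ √A := by
  refine Real.le_sqrt_of_sq_le ?_
  rw [stepSpeed, norm_piecewiseConstLp_sq]
  simp only [div_pow, ← Finset.sum_div]
  rw [sq τ, ← mul_div_assoc, mul_div_mul_left _ _ hτ.ne', div_le_iff₀ hτ]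
  exact hA

theorem dist_piecewiseConst_le {s t : ℝ} (hs : 0 ≤ s) (hst : s ≤ t) (ht : t ≤ N * τ) :
    dist (piecewiseConst τ y s) (piecewiseConst τ y t) ≤
      (∫ r in s..t, stepSpeed hτ N y r) + ‖stepSpeed hτ N y‖ * √τ := by
  let speed : ℕ → ℝ := fun n => dist (y n) (y (n + 1)) / τ
  set v := stepSpeed hτ N y with hv
  set m := ⌈s / τ⌉₊ - 1 with hm
  set n := ⌈t / τ⌉₊ - 1 with hn
  have hmn : m ≤ n := by rw [hm, hn]; gcongr
  have hms : m * τ ≤ s := natCeil_sub_one_mul_le hτ hs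
  have hsm : s ≤ m * τ + τ := le_natCeil_sub_one_mul_add hτ s
  have hnt : n * τ ≤ t := natCeil_sub_one_mul_le hτ (hs.trans hst)
  have hm₀ : 0 ≤ m * τ := by positivity
  calc dist (piecewiseConst τ y s) (piecewiseConst τ y t)
      = dist (y m) (y n) := rfl
    _ ≤ ∑ k ∈ Finset.Ico m n, τ * speed k :=
        (dist_le_Ico_sum_dist y hmn).trans_eq (by simp [speed, mul_div_cancel₀ _ hτ.ne'])
    _ = ∫ r in (m * τ)..(n * τ), piecewiseConst τ speed r :=
        (integral_piecewiseConst hτ speed hmn).symm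
    _ = ∫ r in (m * τ)..(n * τ), v r := by
        rw [hv, stepSpeed, integral_piecewiseConstLp hτ N speed hm₀ (by gcongr) (hnt.trans ht)]
    _ ≤ ∫ r in (m * τ)..t, v r := by
        refine intervalIntegral.integral_mono_interval le_rfl (by gcongr) hnt ?_
          (intervalIntegrable_coeFn v _ _)
        exact ae_restrict_of_ae (piecewiseConstLp_nonneg hτ N _ fun k => by positivity)
    _ = (∫ r in s..t, v r) + ∫ r in (m * τ)..s, v r := by
        rw [add_comm, intervalIntegral.integral_add_adjacent_intervals] <;>
          exact intervalIntegrable_coeFn v _ _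
    _ ≤ (∫ r in s..t, v r) + ‖v‖ * √τ := by
        gcongr
        refine (intervalIntegral_le_norm_mul_sqrt v hms).trans ?_
        gcongr
        linarith

end StepSpeed

theorem exists_subseq_tendstoUniformlyOn_piecewiseConst {Y : Type*} [PseudoMetricSpace Y]
    [CompactSpace Y] {A T : ℝ} {τ : ℕ → ℝ} {N : ℕ → ℕ} {y : ℕ → ℕ → Y} (hτ : ∀ k, 0 < τ k)
    (hτ₀ : Tendsto τ atTop (𝓝 0)) (hT : ∀ k, T ≤ N k * τ k)
    (hA : ∀ k, ∑ n ∈ Finset.range (N k), dist (y k n) (y k (n + 1)) ^ 2 ≤ A * τ k) :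
    ∃ ψ : ℕ → ℕ, StrictMono ψ ∧ ∃ g : ℝ → Y,
      TendstoUniformlyOn (fun k => piecewiseConst (τ (ψ k)) (y (ψ k))) g atTop (Icc 0 T) ∧
      ∃ w : Lp ℝ 2 (volume : Measure ℝ), ‖w‖ ≤ √A ∧
        ∀ s t, 0 ≤ s → s ≤ t → t ≤ T → dist (g s) (g t) ≤ ∫ r in s..t, w r := by
  have norm_speed_le (k : ℕ) : ‖stepSpeed (hτ k) (N k) (y k)‖ ≤ √A :=
    norm_stepSpeed_le (hτ k) (N k) (y k) (hA k)
  have error_tendsto : Tendsto (fun k => √A * √(τ k)) atTop (𝓝 0) := by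
    simpa using hτ₀.sqrt.const_mul √A
  refine exists_subseq_tendstoUniformlyOn_of_dist_le_integral
    (u := fun k => piecewiseConst (τ k) (y k)) norm_speed_le error_tendsto
    fun k s t hs hst ht => ?_
  refine (dist_piecewiseConst_le (hτ k) (N k) (y k) hs hst (ht.trans (hT k))).trans ?_
  gcongr
  exact norm_speed_le k

section Scheme

theorem sq_dist_le_of_sq_dist_div_add_le {Y : Type*} [PseudoMetricSpace Y] {x₀ x₁ x₂ z : Y}
    {θ h E₁ E₂ : ℝ} (hz : dist x₁ z ≤ θ * dist x₀ x₁) (hh : 0 < h)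
    (hmin : dist x₂ z ^ 2 / (2 * h) + E₂ ≤ dist x₁ z ^ 2 / (2 * h) + E₁) :
    dist x₁ x₂ ^ 2 ≤ 4 * θ ^ 2 * dist x₀ x₁ ^ 2 + 4 * h * (E₁ - E₂) := by
  have minimality : dist x₂ z ^ 2 ≤ dist x₁ z ^ 2 + 2 * h * (E₁ - E₂) := by
    field_simp at hmin
    linarith
  calc dist x₁ x₂ ^ 2
      ≤ (dist x₁ z + dist x₂ z) ^ 2 := by gcongr; exact dist_triangle_right _ _ _
    _ ≤ 2 * (dist x₁ z ^ 2 + dist x₂ z ^ 2) := add_sq_le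
    _ ≤ 4 * dist x₁ z ^ 2 + 4 * h * (E₁ - E₂) := by linarith
    _ ≤ 4 * (θ * dist x₀ x₁) ^ 2 + 4 * h * (E₁ - E₂) := by gcongr
    _ = 4 * θ ^ 2 * dist x₀ x₁ ^ 2 + 4 * h * (E₁ - E₂) := by ring

theorem one_sub_mul_sum_le_of_le_mul_add_sub {s F : ℕ → ℝ} {q : ℝ} {N : ℕ}
    (h : ∀ n < N, s (n + 1) ≤ q * s n + (F n - F (n + 1))) :
    (1 - q) * ∑ n ∈ Finset.range (N + 1), s n + q * s N + F N ≤ s 0 + F 0 := by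
  induction N with
  | zero => simp; linarith
  | succ N ih =>
    rw [Finset.sum_range_succ]
    linarith [ih fun n hn => h n (hn.trans N.lt_succ_self), h N N.lt_succ_self]

variable {d : ℕ} {Ω : Set (Space d)} {hΩ : IsCompact Ω} {𝓔 : POn Ω → EReal}
  {X : P2 d → P2 d → P2 d} {β τ θ : ℝ} {N : ℕ} {ρ : ℕ → POn Ω}

theorem IsSchemeSolution.energy_ne_top (hρ : IsSchemeSolution hΩ 𝓔 X β τ N ρ)
    (h₁ : 𝓔 (ρ 1) ≠ ⊤) {n : ℕ} (hn : n < N) : 𝓔 (ρ (n + 1)) ≠ ⊤ := by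
  induction n with
  | zero => exact h₁
  | succ n ih =>
    intro htop
    have hmin := hρ n hn (ρ (n + 1))
    rw [htop, EReal.coe_add_top, top_le_iff] at hmin
    exact EReal.add_ne_top (EReal.coe_ne_top _) (ih (n.lt_succ_self.trans hn)) hmin

theorem IsSchemeSolution.sq_W2_le (hρ : IsSchemeSolution hΩ 𝓔 X β τ N ρ)
    (hX : IsDissipative X θ) (hβ : β < 1) (hτ : 0 < τ) {n : ℕ} (hn : n + 2 ≤ N) {E₁ E₂ : ℝ}
    (hE₁ : 𝓔 (ρ (n + 1)) = E₁) (hE₂ : 𝓔 (ρ (n + 2)) = E₂) :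
    W2 (ρ (n + 1)).1 (ρ (n + 2)).1 ^ 2 ≤
      4 * θ ^ 2 * W2 (ρ n).1 (ρ (n + 1)).1 ^ 2 + 4 * ((1 - β) * τ) * (E₁ - E₂) := by
  have hmin := hρ n hn (ρ (n + 1))
  rw [hE₁, hE₂, mul_assoc] at hmin
  let x (k : ℕ) : WassersteinSpace d := (ρ k).toWassersteinSpace hΩ
  exact sq_dist_le_of_sq_dist_div_add_le (x₀ := x n) (x₁ := x (n + 1)) (x₂ := x (n + 2))
    (z := X (x n) (x (n + 1))) (hX.2 _ _) (mul_pos (sub_pos.2 hβ) hτ) (by exact_mod_cast hmin)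

theorem IsSchemeSolution.sum_sq_W2_le (hρ : IsSchemeSolution hΩ 𝓔 X β τ N ρ)
    (hX : IsDissipative X θ) (hθ : θ < 1 / 2) (hβ : β < 1) (hτ : 0 < τ) {m E₀ C : ℝ}
    (hm : ∀ σ, (m : EReal) ≤ 𝓔 σ) (hE₀ : 𝓔 (ρ 1) ≤ E₀)
    (hC : W2 (ρ 0).1 (ρ 1).1 ^ 2 ≤ C * τ) (hN : 1 ≤ N) :
    ∑ n ∈ Finset.range N, W2 (ρ n).1 (ρ (n + 1)).1 ^ 2 ≤
      (C + 4 * (1 - β) * (E₀ - m)) / (1 - 4 * θ ^ 2) * τ := by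
  obtain ⟨N, rfl⟩ := Nat.exists_eq_add_of_le' hN
  let E (n : ℕ) : ℝ := (𝓔 (ρ (n + 1))).toReal
  have coe_E {n : ℕ} (hn : n < N + 1) : 𝓔 (ρ (n + 1)) = E n :=
    (EReal.coe_toReal (hρ.energy_ne_top (ne_top_of_le_ne_top (EReal.coe_ne_top _) hE₀) hn)
      (ne_bot_of_le_ne_bot (EReal.coe_ne_bot _) (hm _))).symm
  have E_zero_le : E 0 ≤ E₀ := by exact_mod_cast (coe_E N.succ_pos).symm.trans_le hE₀
  have le_E_last : m ≤ E N := by exact_mod_cast (hm _).trans_eq (coe_E N.lt_succ_self)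
  have telescoped := one_sub_mul_sum_le_of_le_mul_add_sub (N := N) (q := 4 * θ ^ 2)
    (s := fun n => W2 (ρ n).1 (ρ (n + 1)).1 ^ 2) (F := fun n => 4 * ((1 - β) * τ) * E n)
    fun n hn => by
      rw [← mul_sub]
      exact hρ.sq_W2_le hX hβ hτ (Nat.succ_lt_succ hn) (coe_E (hn.trans N.lt_succ_self))
        (coe_E (Nat.succ_lt_succ hn))
  have hh : 0 < (1 - β) * τ := mul_pos (sub_pos.2 hβ) hτ
  rw [div_mul_eq_mul_div, le_div_iff₀ (by nlinarith [hX.1])]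
  have energy_drop : 4 * ((1 - β) * τ) * (E 0 - E N) ≤ 4 * ((1 - β) * τ) * (E₀ - m) :=
    mul_le_mul_of_nonneg_left (sub_le_sub E_zero_le le_E_last) (mul_nonneg zero_le_four hh.le)
  have : 0 ≤ 4 * θ ^ 2 * W2 (ρ N).1 (ρ (N + 1)).1 ^ 2 := by positivity
  linarith

end Scheme

section Geodesic

theorem exists_mem_Ioc_natCast_mul {τ t : ℝ} (hτ : 0 < τ) {N : ℕ} (ht₀ : 0 < t) (ht : t ≤ N * τ) :
    ∃ n < N, t ∈ Ioc (n * τ) ((n + 1) * τ) := by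
  obtain ⟨n, hn⟩ := Nat.exists_eq_succ_of_ne_zero (Nat.ceil_pos.2 (div_pos ht₀ hτ)).ne'
  refine ⟨n, ?_, ?_, ?_⟩
  · rw [← Nat.succ_le_iff, ← hn]
    exact Nat.ceil_le.2 ((div_le_iff₀ hτ).2 ht)
  · rw [← lt_div_iff₀ hτ]
    exact Nat.lt_ceil.1 (hn ▸ n.lt_succ_self)
  · rw [← div_le_iff₀ hτ]
    exact_mod_cast Nat.ceil_le.1 hn.le

theorem IsGeodesicOn.W2_left_le {d : ℕ} {ω : ℝ → P2 d} {t₀ t₁ t : ℝ} (hω : IsGeodesicOn ω t₀ t₁)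
    (ht : t ∈ Icc t₀ t₁) : W2 (ω t₀).1 (ω t).1 ≤ W2 (ω t₀).1 (ω t₁).1 := by
  have h₀₁ := ht.1.trans ht.2
  rw [hω t₀ (left_mem_Icc.2 h₀₁) t ht]
  refine mul_le_of_le_one_left (Real.sqrt_nonneg _) (div_le_one_of_le₀ ?_ (abs_nonneg _))
  rw [abs_of_nonneg (sub_nonneg.2 ht.1), abs_of_nonneg (sub_nonneg.2 h₀₁)]
  linarith [ht.2]

theorem IsGeodesicInterpolation.W2_piecewiseConst_le {d : ℕ} {τ r : ℝ} {N : ℕ} {ρ : ℕ → P2 d}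
    {ω : ℝ → P2 d} (hω : IsGeodesicInterpolation τ N ρ ω) (hτ : 0 < τ) (hN : 1 ≤ N)
    (hr : ∀ n < N, W2 (ρ n).1 (ρ (n + 1)).1 ≤ r) {t : ℝ} (ht : t ∈ Icc 0 (N * τ)) :
    W2 (piecewiseConst τ ρ t).1 (ω t).1 ≤ r := by
  rcases ht.1.eq_or_lt with rfl | ht₀
  · have hω₀ : ω 0 = ρ 0 := by simpa using (hω 0 hN).1
    rw [piecewiseConst_zero, hω₀]
    exact (dist_self (α := WassersteinSpace d) (ρ 0)).trans_le
      ((Real.sqrt_nonneg _).trans (hr 0 hN))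
  · obtain ⟨n, hn, htn⟩ := exists_mem_Ioc_natCast_mul hτ ht₀ ht.2
    obtain ⟨hleft, hright, hgeo⟩ := hω n hn
    have h := hgeo.W2_left_le (Ioc_subset_Icc_self htn)
    rw [hleft, hright] at h
    rw [piecewiseConst_of_mem hτ ρ n htn]
    exact h.trans (hr n hn)

end Geodesic

section Convergence

variable {d : ℕ} {Ω : Set (Space d)} {A T : ℝ}

theorem exists_subseq_tendsto_isAbsolutelyContinuousCurve (hΩ : IsCompact Ω)
    {τ : ℕ → ℝ} {N : ℕ → ℕ} {ρ : ℕ → ℕ → POn Ω} (hτ : ∀ k, 0 < τ k)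
    (hτ₀ : Tendsto τ atTop (𝓝 0)) (hT : ∀ k, T ≤ N k * τ k)
    (hA : ∀ k, ∑ n ∈ Finset.range (N k), W2 (ρ k n).1 (ρ k (n + 1)).1 ^ 2 ≤ A * τ k) :
    ∃ ψ : ℕ → ℕ, StrictMono ψ ∧ ∃ ϱ : ℝ → POn Ω,
      (∀ ε : ℝ, 0 < ε → ∀ᶠ k in atTop, ∀ t ∈ Icc 0 T,
        W2 (piecewiseConst (τ (ψ k)) (ρ (ψ k)) t).1 (ϱ t).1 < ε) ∧
      IsAbsolutelyContinuousCurve T ϱ ∧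
      ∀ s ∈ Icc 0 T, ∀ t ∈ Icc 0 T, W2 (ϱ s).1 (ϱ t).1 ≤ √A * √|t - s| := by
  have := isCompact_iff_compactSpace.1 (isCompact_range_toWassersteinSpace hΩ)
  obtain ⟨ψ, hψ, g, hg, w, hw, hgw⟩ := exists_subseq_tendstoUniformlyOn_piecewiseConst
    (y := fun k n => rangeFactorization (POn.toWassersteinSpace hΩ) (ρ k n)) hτ hτ₀ hT hA
  obtain ⟨ϱ, rfl⟩ := rangeFactorization_surjective.comp_left g
  refine ⟨ψ, hψ, ϱ, fun ε hε => ?_, ⟨w, intervalIntegrable_coeFn w 0 T, hgw⟩,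
    fun s hs t ht => ?_⟩
  · filter_upwards [Metric.tendstoUniformlyOn_iff.1 hg ε hε] with k hk t ht
    exact (dist_comm _ _).trans_lt (hk t ht)
  · wlog hst : s ≤ t generalizing s t
    · rw [abs_sub_comm, W2_eq_toReal_eW2, eW2_comm, ← W2_eq_toReal_eW2]
      exact this t ht s hs (le_of_not_ge hst)
    rw [abs_of_nonneg (sub_nonneg.2 hst)]
    calc W2 (ϱ s).1 (ϱ t).1
        ≤ ∫ r in s..t, w r := hgw s t hs.1 hst ht.2
      _ ≤ ‖w‖ * √(t - s) := intervalIntegral_le_norm_mul_sqrt w hst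
      _ ≤ √A * √(t - s) := by gcongr

theorem IsGeodesicInterpolation.W2_piecewiseConst_le_sqrt (hΩ : IsCompact Ω) {τ : ℝ} {N : ℕ}
    {ρ : ℕ → POn Ω} {ω : ℝ → P2 d}
    (hω : IsGeodesicInterpolation τ N (fun n => (ρ n).toP2 hΩ) ω) (hτ : 0 < τ) (hN : 1 ≤ N)
    (hA : ∑ n ∈ Finset.range N, W2 (ρ n).1 (ρ (n + 1)).1 ^ 2 ≤ A * τ) {t : ℝ}
    (ht : t ∈ Icc 0 (N * τ)) : W2 (piecewiseConst τ ρ t).1 (ω t).1 ≤ √A * √τ := by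
  refine hω.W2_piecewiseConst_le hτ hN (fun n hn => ?_) ht
  rw [← Real.sqrt_mul' A hτ.le]
  exact Real.le_sqrt_of_sq_le ((Finset.single_le_sum
    (f := fun n => W2 (ρ n).1 (ρ (n + 1)).1 ^ 2) (fun _ _ => sq_nonneg _)
    (Finset.mem_range.2 hn)).trans hA)

end Convergence

theorem exists_real_forall_le_of_lowerSemicontinuous {S : Type*} [TopologicalSpace S]
    [CompactSpace S] {f : S → EReal} (hf : LowerSemicontinuous f) (hbot : ∀ x, f x ≠ ⊥) :
    ∃ m : ℝ, ∀ x, (m : EReal) ≤ f x := by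
  cases isEmpty_or_nonempty S
  · exact ⟨0, isEmptyElim⟩
  obtain ⟨x₀, -, hx₀⟩ :=
    (hf.lowerSemicontinuousOn univ).exists_isMinOn univ_nonempty isCompact_univ
  obtain ⟨m, -, hm⟩ := EReal.lt_iff_exists_real_btwn.1 (bot_lt_iff_ne_bot.2 (hbot x₀))
  exact ⟨m, fun x => hm.le.trans (hx₀ (mem_univ x))⟩

end EVBDF2

open EVBDF2 in
theorem mainTheorem6_general {d : ℕ} {Ω : Set (Space d)} (hΩ : IsCompact Ω)
    (𝓔 : POn Ω → EReal) {m : ℝ} (hm : ∀ σ, (m : EReal) ≤ 𝓔 σ)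
    (ρ₀ : POn Ω) (h𝓔_fin : 𝓔 ρ₀ ≠ ⊤) {β θ : ℝ} (C : ℝ) (hβ : β < 1) (hθ : θ < 1 / 2) :
    ∃ K : ℝ, ∀ T : ℝ, 0 < T → ∀ X : P2 d → P2 d → P2 d, IsDissipative X θ →
      ∀ ρ : ℕ → ℕ → POn Ω,
        (∀ N : ℕ, 1 ≤ N → ρ N 0 = ρ₀ ∧ W2 ρ₀.1 (ρ N 1).1 ^ 2 ≤ C * (T / N) ∧
          𝓔 (ρ N 1) ≤ 𝓔 ρ₀ ∧ IsSchemeSolution hΩ 𝓔 X β (T / N) N (ρ N)) →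
        (∀ φ : ℕ → ℕ, StrictMono φ → ∃ ψ : ℕ → ℕ, StrictMono ψ ∧ ∃ ϱ : ℝ → POn Ω,
          (∀ ε : ℝ, 0 < ε → ∀ᶠ k in atTop, ∀ t ∈ Icc 0 T,
            W2 (piecewiseConst (T / (φ (ψ k) : ℝ)) (ρ (φ (ψ k))) t).1 (ϱ t).1 < ε) ∧
          IsAbsolutelyContinuousCurve T ϱ ∧
          ∀ s ∈ Icc 0 T, ∀ t ∈ Icc 0 T, W2 (ϱ s).1 (ϱ t).1 ≤ K * √|t - s|) ∧
        ∀ N : ℕ, 1 ≤ N → ∀ ω : ℝ → P2 d,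
          IsGeodesicInterpolation (T / N) N (fun n => (ρ N n).toP2 hΩ) ω →
          ∀ t ∈ Icc 0 T, W2 (piecewiseConst (T / N) (ρ N) t).1 (ω t).1 ≤ K * √(T / N) := by
  let A := (C + 4 * (1 - β) * ((𝓔 ρ₀).toReal - m)) / (1 - 4 * θ ^ 2)
  refine ⟨√A, fun T hT X hX ρ hρ => ?_⟩
  have τ_pos {N : ℕ} (hN : 1 ≤ N) : 0 < T / N := div_pos hT (Nat.cast_pos.2 hN)
  have N_mul_τ {N : ℕ} (hN : 1 ≤ N) : N * (T / N) = T :=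
    mul_div_cancel₀ T (Nat.cast_ne_zero.2 (Nat.one_le_iff_ne_zero.1 hN))
  have energy_estimate {N : ℕ} (hN : 1 ≤ N) :
      ∑ n ∈ Finset.range N, W2 (ρ N n).1 (ρ N (n + 1)).1 ^ 2 ≤ A * (T / N) := by
    obtain ⟨h₀, hC, h₁, hscheme⟩ := hρ N hN
    exact hscheme.sum_sq_W2_le hX hθ hβ (τ_pos hN) hm (h₁.trans (EReal.le_coe_toReal h𝓔_fin))
      (h₀ ▸ hC) hN
  refine ⟨fun φ hφ => ?_, fun N hN ω hω t ht =>
    hω.W2_piecewiseConst_le_sqrt hΩ (τ_pos hN) hN (energy_estimate hN) ((N_mul_τ hN).symm ▸ ht)⟩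
  -- `φ 0` may vanish, so the subsequence is shifted by one.
  have φ_pos (k : ℕ) : 1 ≤ φ (k + 1) := k.succ_pos.trans_le (hφ.le_apply)
  have τ_tendsto : Tendsto (fun k => T / φ (k + 1)) atTop (𝓝 0) :=
    (tendsto_const_div_atTop_nhds_zero_nat T).comp
      (hφ.tendsto_atTop.comp (tendsto_add_atTop_nat 1))
  obtain ⟨ψ, hψ, ϱ, hϱ⟩ := exists_subseq_tendsto_isAbsolutelyContinuousCurve hΩ
    (fun k => τ_pos (φ_pos k)) τ_tendsto (fun k => (N_mul_τ (φ_pos k)).ge)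
    fun k => energy_estimate (φ_pos k)
  exact ⟨fun k => ψ k + 1, fun _ _ hkl => Nat.succ_lt_succ (hψ hkl), ϱ, hϱ⟩

theorem mainTheorem6 {d : ℕ} {Ω : Set (EVBDF2.Space d)} (hΩ : IsCompact Ω)
    (hconv : Convex ℝ Ω)
    (𝓔 : EVBDF2.POn Ω → EReal) (h𝓔_lsc : LowerSemicontinuous 𝓔) (h𝓔_bot : ∀ σ, 𝓔 σ ≠ ⊥)
    (ρ₀ : EVBDF2.POn Ω) (h𝓔_fin : 𝓔 ρ₀ ≠ ⊤)
    (β θ C : ℝ) (hβ0 : 0 ≤ β) (hβ1 : β < 1) (hθ : θ < 1 / 2) (hC : 0 < C) :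
    -- the constant `K` depends only on `Ω`, `𝓔`, `ρ₀`, `β`, `θ` and `C`
    ∃ K : ℝ, ∀ (T : ℝ), 0 < T →
      ∀ (X : EVBDF2.P2 d → EVBDF2.P2 d → EVBDF2.P2 d), EVBDF2.IsDissipative X θ →
      -- `ρ N 0, …, ρ N N` is the discrete solution with time step `T / N`
      ∀ (ρ : ℕ → ℕ → EVBDF2.POn Ω),
        (∀ N : ℕ, 1 ≤ N →
          ρ N 0 = ρ₀ ∧
          EVBDF2.W2 ρ₀.1 (ρ N 1).1 ^ 2 ≤ C * (T / N) ∧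
          𝓔 (ρ N 1) ≤ 𝓔 ρ₀ ∧
          EVBDF2.IsSchemeSolution hΩ 𝓔 X β (T / N) N (ρ N)) →
        -- every subsequence has a uniformly convergent further subsequence
        (∀ φ : ℕ → ℕ, StrictMono φ →
          ∃ ψ : ℕ → ℕ, StrictMono ψ ∧ ∃ ϱ : ℝ → EVBDF2.POn Ω,
            (∀ ε : ℝ, 0 < ε → ∀ᶠ k in Filter.atTop, ∀ t ∈ Set.Icc (0 : ℝ) T,
              EVBDF2.W2
                (EVBDF2.piecewiseConst (T / (φ (ψ k) : ℝ)) (ρ (φ (ψ k))) t).1 (ϱ t).1 < ε) ∧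
            EVBDF2.IsAbsolutelyContinuousCurve T ϱ ∧
            (∀ s ∈ Set.Icc (0 : ℝ) T, ∀ t ∈ Set.Icc (0 : ℝ) T,
              EVBDF2.W2 (ϱ s).1 (ϱ t).1 ≤ K * Real.sqrt |t - s|)) ∧
        -- distance between the piecewise constant curve and any geodesic interpolation
        (∀ N : ℕ, 1 ≤ N → ∀ ω : ℝ → EVBDF2.P2 d,
          EVBDF2.IsGeodesicInterpolation (T / N) N (fun n => (ρ N n).toP2 hΩ) ω →
          ∀ t ∈ Set.Icc (0 : ℝ) T,
            EVBDF2.W2 (EVBDF2.piecewiseConst (T / N) (ρ N) t).1 (ω t).1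
              ≤ K * Real.sqrt (T / N)) := by
  have := EVBDF2.compactSpace_POn hΩ
  obtain ⟨m, hm⟩ := EVBDF2.exists_real_forall_le_of_lowerSemicontinuous h𝓔_lsc h𝓔_bot
  exact mainTheorem6_general hΩ 𝓔 hm ρ₀ h𝓔_fin C hβ1 hθ
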